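/- Let $T$ be a full binary tree with $n$ leaves, labelled bijectively by $[n]=\{1,\dots,n\}$, and let $\tilde p_1,\dots,\tilde p_n\in[0,1]$ satisfy $\sum_{i=1}^n\tilde p_i=k$ for an integer $k\ge 0$. Binary-tree-based pivotal sampling draws a random set $\mathcal A\subseteq[n]$ as follows. Start with $\mathcal A=\emptyset$, each leaf storing its label. While the tree has more than one node, select any pair of sibling leaves (the choice may depend on the previous outcomes), storing indices $i$ and $j$, say, and let them compete: \begin{itemize} \item If $\tilde p_i+\tilde p_j\le 1$: with probability $\frac{\tilde p_i}{\tilde p_i+\tilde p_j}$ set $\tilde p_i\gets\tilde p_i+\tilde p_j$, $\tilde p_j\gets 0$ and store $i$ at the parent; otherwise set $\tilde p_j\gets\tilde p_i+\tilde p_j$, $\tilde p_i\gets 0$ and store $j$ at the parent. \item If $\tilde p_i+\tilde p_j>1$: with probability $\frac{1-\tilde p_i}{2-\tilde p_i-\tilde p_j}$ set $\tilde p_i\gets\tilde p_i+\tilde p_j-1$, $\tilde p_j\gets 1$, store $i$ at the parent and add $j$ to $\mathcal A$; otherwise set $\tilde p_j\gets\tilde p_i+\tilde p_j-1$, $\tilde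 p_i\gets 1$, store $j$ at the parent and add $i$ to $\mathcal A$. \end{itemize} (A quotient $0/0$ is read as $0$.) Then remove the two leaves, so that the parent becomes a leaf. When only the root is left, add the index stored there to $\mathcal A$ if its current probability is $1$. Let $\xi_i\in\{0,1\}$ be the indicator of $i\in\mathcal A$. Let $\mathcal S\subseteq[n]$ be such that $\Pr[\xi_l=1\ \forall l\in\mathcal S]>0$. Then, conditioned on $\xi_l=1$ for all $l\in\mathcal S$, the remaining indicators are pairwise negatively correlated: for any two distinct $i,j\in[n]\setminus\mathcal S$, $$\Pr[\xi_i=1\mid \xi_l=1\ \forall l\in\mathcal S]\cdot\Pr[\xi_j=1\mid \xi_l=1\ \forall l\in\mathcal S]\ \ge\ \Pr[\xi_i=1,\ \xi_j=1\mid \xi_l=1\ \forall l\in\mathcal S].$$ -/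

import Mathlib

open MeasureTheory ProbabilityTheory

namespace PivotalSampling

/-- Full binary trees (every node has no child or two children) storing an index at each leaf. -/
inductive IndexTree (ι : Type) : Type
  | leaf (i : ι) : IndexTree ι
  | node (l r : IndexTree ι) : IndexTree ι

/-- The indices stored at the leaves, from left to right. -/
def IndexTree.leaves {ι : Type} : IndexTree ι → List ι
  | .leaf i => [i]
  | .node l r => l.leaves ++ r.leaves

/-- `SiblingPair T i j C`: the tree `T` has two sibling leaves (in either order) storing `i` and
`j`, and `C x` is the tree that results from `T` when these two leaves are removed and `x` is
stored at their parent. -/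
inductive SiblingPair {ι : Type} : IndexTree ι → ι → ι → (ι → IndexTree ι) → Prop
  | here (i j : ι) : SiblingPair (.node (.leaf i) (.leaf j)) i j .leaf
  | swapped (i j : ι) : SiblingPair (.node (.leaf j) (.leaf i)) i j .leaf
  | left {l r : IndexTree ι} {i j : ι} {C : ι → IndexTree ι} (h : SiblingPair l i j C) :
      SiblingPair (.node l r) i j (fun x => .node (C x) r)
  | right {l r : IndexTree ι} {i j : ι} {C : ι → IndexTree ι} (h : SiblingPair r i j C) :
      SiblingPair (.node l r) i j (fun x => .node l (C x))

/-- The mixture `q μ + (1 - q) ν`: with probability `q` proceed as in `μ`,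
otherwise as in `ν`. -/
noncomputable def mix {Ω : Type} [MeasurableSpace Ω] (q : ℝ) (μ ν : Measure Ω) : Measure Ω :=
  ENNReal.ofReal q • μ + ENNReal.ofReal (1 - q) • ν

/-- `RunLaw T p A μ`: if the pivotal method is in the state with remaining tree `T`, current
inclusion probabilities `p` and set `A` of indices selected so far, then some way of choosing the
sibling pairs (which may depend on all earlier random outcomes) makes `μ` the law of the
indicator vector `ξ` of the final sample.

* `done`: one node is left; its index is in the sample if its probability has become `1`.
* `low`, `high`: a match between sibling leaves storing `i` and `j`, when `p i + p j ≤ 1` and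
  when `p i + p j > 1`, respectively.

The quotients are `0 / 0` only if `p i = p j = 0` or `p i = p j = 1`; the two outcomes of the match
then differ only in which of two equal competitors moves up. -/
inductive RunLaw {ι : Type} [DecidableEq ι] :
    IndexTree ι → (ι → ℝ) → Finset ι → Measure (ι → Bool) → Prop
  | done (r : ι) (p : ι → ℝ) (A : Finset ι) :
      RunLaw (.leaf r) p A
        (Measure.dirac (fun i => decide (i ∈ if p r = 1 then insert r A else A)))
  | low {T : IndexTree ι} {i j : ι} {C : ι → IndexTree ι} {p : ι → ℝ} {A : Finset ι}
      {μ ν : Measure (ι → Bool)} (hT : SiblingPair T i j C) (hp : p i + p j ≤ 1)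
      (hi : RunLaw (C i) (Function.update (Function.update p i (p i + p j)) j 0) A μ)
      (hj : RunLaw (C j) (Function.update (Function.update p j (p i + p j)) i 0) A ν) :
      RunLaw T p A (mix (p i / (p i + p j)) μ ν)
  | high {T : IndexTree ι} {i j : ι} {C : ι → IndexTree ι} {p : ι → ℝ} {A : Finset ι}
      {μ ν : Measure (ι → Bool)} (hT : SiblingPair T i j C) (hp : 1 < p i + p j)
      (hi : RunLaw (C i) (Function.update (Function.update p i (p i + p j - 1)) j 1)
        (insert j A) μ)
      (hj : RunLaw (C j) (Function.update (Function.update p j (p i + p j - 1)) i 1)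
        (insert i A) ν) :
      RunLaw T p A (mix ((1 - p i) / (2 - p i - p j)) μ ν)

/-- `μ` is the law of the indicator vector of the sample drawn by binary-tree-based pivotal
sampling on the tree `T` with inclusion probabilities `p`. -/
def IsPivotalLaw {ι : Type} [DecidableEq ι] (T : IndexTree ι) (p : ι → ℝ)
    (μ : Measure (ι → Bool)) : Prop :=
  RunLaw T p ∅ μ

end PivotalSampling

/-!
The order of the matches is irrelevant, because a subtree is summarised by the probability held by
the index that moves up to its root and by the pair of joint probabilities that all prescribed
indices of the subtree are selected while the index at its root finally is, or is not, selected. A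
match combines the pairs of two subtrees by a bilinear map that is symmetric in the two
competitors. Given a pair of indices to be added to the prescribed ones, the inequality
`P(S ∪ {i, j}) P(S) ≤ P(S ∪ {i}) P(S ∪ {j})` holds for every positive linear functional of the
pair of the tree, by induction: if `i` and `j` lie in the same subtree of the root, then the other
subtree only changes the functional; if they are separated, then the functional of the match is a
bilinear form with nonpositive determinant, and prescribing one more index moves the pair of its
subtree up in the likelihood ratio order.
-/

namespace PivotalSampling

lemma cond_inter_le_mul_of_measureReal_mul_le {Ω : Type*} [MeasurableSpace Ω] {μ : Measure Ω}
    {s t u : Set Ω} (hs : MeasurableSet s) (hμs : μ s ≠ 0) (hμs' : μ s ≠ ⊤)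
    (h : μ.real (s ∩ (t ∩ u)) * μ.real s ≤ μ.real (s ∩ t) * μ.real (s ∩ u)) :
    μ[t ∩ u | s] ≤ μ[t | s] * μ[u | s] := by
  have hs_pos : 0 < μ.real s := ENNReal.toReal_pos hμs hμs'
  have := cond_isProbabilityMeasure_of_finite hμs hμs'
  have hcond (v : Set Ω) : (μ[v | s]).toReal = (μ.real s)⁻¹ * μ.real (s ∩ v) := by
    rw [cond_apply hs, ENNReal.toReal_mul, ENNReal.toReal_inv, measureReal_def, measureReal_def]
  rw [← ENNReal.toReal_le_toReal (measure_ne_top _ _) (by finiteness), ENNReal.toReal_mul, hcond,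
    hcond, hcond]
  calc (μ.real s)⁻¹ * μ.real (s ∩ (t ∩ u))
      = (μ.real s)⁻¹ * (μ.real s)⁻¹ * (μ.real (s ∩ (t ∩ u)) * μ.real s) := by field_simp
    _ ≤ (μ.real s)⁻¹ * (μ.real s)⁻¹ * (μ.real (s ∩ t) * μ.real (s ∩ u)) := by gcongr
    _ = (μ.real s)⁻¹ * μ.real (s ∩ t) * ((μ.real s)⁻¹ * μ.real (s ∩ u)) := by ring

instance isFiniteMeasure_mix {Ω : Type} [MeasurableSpace Ω] (q : ℝ) (μ ν : Measure Ω)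
    [IsFiniteMeasure μ] [IsFiniteMeasure ν] : IsFiniteMeasure (mix q μ ν) :=
  have := μ.smul_finite (ENNReal.ofReal_ne_top (r := q))
  have := ν.smul_finite (ENNReal.ofReal_ne_top (r := 1 - q))
  isFiniteMeasureAdd

lemma mix_real_apply {Ω : Type} [MeasurableSpace Ω] {q : ℝ} (hq : q ∈ Set.Icc (0 : ℝ) 1)
    (μ ν : Measure Ω) [IsFiniteMeasure μ] [IsFiniteMeasure ν] (s : Set Ω) :
    (mix q μ ν).real s = q * μ.real s + (1 - q) * ν.real s := by
  have := μ.smul_finite (ENNReal.ofReal_ne_top (r := q))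
  have := ν.smul_finite (ENNReal.ofReal_ne_top (r := 1 - q))
  rw [mix, measureReal_add_apply, measureReal_ennreal_smul_apply, measureReal_ennreal_smul_apply,
    ENNReal.toReal_ofReal hq.1, ENNReal.toReal_ofReal (sub_nonneg.2 hq.2)]

section Match

/-- The probability left to the competitor that moves up after a match between competitors with
current probabilities `x` and `y`. -/
noncomputable def residual (x y : ℝ) : ℝ := if x + y ≤ 1 then x + y else x + y - 1

/-- How a match between subtrees whose roots carry the probabilities `x` and `y` combines their
pairs `u` and `v` of joint probabilities; see `IndexTree.inclusionPair`.

If `x + y ≤ 1`, then only the first competitor is finally selected with probability `x`, only the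
second with probability `y`, and none with probability `1 - x - y`; the one moving up is selected
in the first two cases. If `x + y > 1`, then both are selected with probability `x + y - 1`, only
the first with probability `1 - y`, and only the second with probability `1 - x`; the one moving
up is selected in the first case. Each coefficient is such a probability divided by its value for
independent competitors, for instance `x / (x * (1 - y))`. A vanishing denominator is harmless,
since joint probabilities have `u.1 = 0` if `x = 0` and `u.2 = 0` if `x = 1`, and likewise for `v`
and `y`. -/
noncomputable def compete (x y : ℝ) : ℝ × ℝ →ₗ[ℝ] ℝ × ℝ →ₗ[ℝ] ℝ × ℝ :=
  LinearMap.mk₂ ℝ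
    (fun u v =>
      if x + y ≤ 1 then
        (u.1 * v.2 / (1 - y) + u.2 * v.1 / (1 - x),
          (1 - x - y) / ((1 - x) * (1 - y)) * (u.2 * v.2))
      else
        ((x + y - 1) / (x * y) * (u.1 * v.1), u.1 * v.2 / x + u.2 * v.1 / y))
    (fun _ _ _ => by split_ifs <;> ext <;> simp <;> ring)
    (fun _ _ _ => by split_ifs <;> ext <;> simp <;> ring)
    (fun _ _ _ => by split_ifs <;> ext <;> simp <;> ring)
    (fun _ _ _ => by split_ifs <;> ext <;> simp <;> ring)

/-- The likelihood ratio order on pairs of weights: passing from `u` to `v` shifts weight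
towards the first component. -/
def LikelihoodRatioLE (u v : ℝ × ℝ) : Prop := v.2 * u.1 ≤ v.1 * u.2

variable {x y : ℝ} {u u' v v' : ℝ × ℝ}

lemma residual_comm (x y : ℝ) : residual x y = residual y x := by
  simp only [residual, add_comm]

lemma residual_mem_Icc (hx : x ∈ Set.Icc (0 : ℝ) 1) (hy : y ∈ Set.Icc (0 : ℝ) 1) :
    residual x y ∈ Set.Icc (0 : ℝ) 1 := by
  obtain ⟨hx0, hx1⟩ := hx
  obtain ⟨hy0, hy1⟩ := hy
  unfold residual
  split_ifs <;> constructor <;> linarith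

lemma compete_of_add_le_one (h : x + y ≤ 1) (u v : ℝ × ℝ) :
    compete x y u v = (u.1 * v.2 / (1 - y) + u.2 * v.1 / (1 - x),
      (1 - x - y) / ((1 - x) * (1 - y)) * (u.2 * v.2)) :=
  if_pos h

lemma compete_of_one_lt_add (h : 1 < x + y) (u v : ℝ × ℝ) :
    compete x y u v =
      ((x + y - 1) / (x * y) * (u.1 * v.1), u.1 * v.2 / x + u.2 * v.1 / y) :=
  if_neg h.not_ge

lemma compete_comm (x y : ℝ) (u v : ℝ × ℝ) : compete x y u v = compete y x v u := by
  rcases le_or_gt (x + y) 1 with h | h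
  · rw [compete_of_add_le_one h, compete_of_add_le_one (by rwa [add_comm])]
    ext <;> ring
  · rw [compete_of_one_lt_add h, compete_of_one_lt_add (by rwa [add_comm])]
    ext <;> ring

lemma compete_nonneg (hx : x ∈ Set.Icc (0 : ℝ) 1) (hy : y ∈ Set.Icc (0 : ℝ) 1)
    (hu : 0 ≤ u) (hv : 0 ≤ v) : 0 ≤ compete x y u v := by
  obtain ⟨hu₁, hu₂⟩ : 0 ≤ u.1 ∧ 0 ≤ u.2 := hu
  obtain ⟨hv₁, hv₂⟩ : 0 ≤ v.1 ∧ 0 ≤ v.2 := hv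
  have hx' := sub_nonneg.2 hx.2
  have hy' := sub_nonneg.2 hy.2
  obtain ⟨hx0, -⟩ := hx
  obtain ⟨hy0, -⟩ := hy
  rcases le_or_gt (x + y) 1 with h | h
  · have : 0 ≤ 1 - x - y := by linarith
    rw [compete_of_add_le_one h]
    constructor <;> dsimp only [Prod.fst_zero, Prod.snd_zero] <;> positivity
  · have : 0 ≤ x + y - 1 := by linarith
    rw [compete_of_one_lt_add h]
    constructor <;> dsimp only [Prod.fst_zero, Prod.snd_zero] <;> positivity

lemma LikelihoodRatioLE.compete_left (hx : x ∈ Set.Icc (0 : ℝ) 1) (hy : y ∈ Set.Icc (0 : ℝ) 1)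
    (h : LikelihoodRatioLE u u') (v : ℝ × ℝ) :
    LikelihoodRatioLE (compete x y u v) (compete x y u' v) := by
  have hx' := sub_nonneg.2 hx.2
  have hy' := sub_nonneg.2 hy.2
  obtain ⟨hx0, -⟩ := hx
  obtain ⟨hy0, -⟩ := hy
  unfold LikelihoodRatioLE at h ⊢
  rw [← sub_nonneg] at h ⊢
  rcases le_or_gt (x + y) 1 with hs | hs
  · have hc : 0 ≤ (1 - x - y) / ((1 - x) * (1 - y)) / (1 - y) * v.2 ^ 2 := by
      have : 0 ≤ 1 - x - y := by linarith
      positivity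
    rw [compete_of_add_le_one hs, compete_of_add_le_one hs]
    exact (mul_nonneg hc h).trans_eq (by ring)
  · have hc : 0 ≤ (x + y - 1) / (x * y) / y * v.1 ^ 2 := by
      have : 0 ≤ x + y - 1 := by linarith
      positivity
    rw [compete_of_one_lt_add hs, compete_of_one_lt_add hs]
    exact (mul_nonneg hc h).trans_eq (by ring)

lemma LikelihoodRatioLE.compete_right (hx : x ∈ Set.Icc (0 : ℝ) 1) (hy : y ∈ Set.Icc (0 : ℝ) 1)
    (u : ℝ × ℝ) (h : LikelihoodRatioLE v v') :
    LikelihoodRatioLE (compete x y u v) (compete x y u v') := by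
  rw [compete_comm x y u v, compete_comm x y u v']
  exact h.compete_left hy hx u

lemma map_compete_mul_map_compete_le {φ : ℝ × ℝ →ₗ[ℝ] ℝ} (hφ : ∀ z, 0 ≤ z → 0 ≤ φ z)
    (hx : x ∈ Set.Icc (0 : ℝ) 1) (hy : y ∈ Set.Icc (0 : ℝ) 1)
    (hu : LikelihoodRatioLE u u') (hv : LikelihoodRatioLE v v') :
    φ (compete x y u' v') * φ (compete x y u v) ≤
      φ (compete x y u' v) * φ (compete x y u v') := by
  have hx' := sub_nonneg.2 hx.2
  have hy' := sub_nonneg.2 hy.2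
  obtain ⟨hx0, -⟩ := hx
  obtain ⟨hy0, -⟩ := hy
  have hφ_apply (z : ℝ × ℝ) : φ z = z.1 * φ (1, 0) + z.2 * φ (0, 1) := by
    rw [← smul_eq_mul, ← smul_eq_mul, ← map_smul, ← map_smul, ← map_add]
    simp
  have huv := mul_nonneg (sub_nonneg.2 hu) (sub_nonneg.2 hv)
  rw [← sub_nonneg]
  simp only [hφ_apply (compete _ _ _ _)]
  -- The difference is `-(det B)` times the two likelihood ratio defects, where `B` is the matrix
  -- of the bilinear form `φ (compete x y · ·)`, one of whose diagonal entries vanishes.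
  rcases le_or_gt (x + y) 1 with hs | hs
  · have hdet : 0 ≤ φ (1, 0) / (1 - y) * (φ (1, 0) / (1 - x)) := by
      have : 0 ≤ φ (1, 0) := hφ _ ⟨zero_le_one, le_rfl⟩
      positivity
    simp only [compete_of_add_le_one hs]
    exact (mul_nonneg hdet huv).trans_eq (by ring)
  · have hdet : 0 ≤ φ (0, 1) / x * (φ (0, 1) / y) := by
      have : 0 ≤ φ (0, 1) := hφ _ ⟨le_rfl, zero_le_one⟩
      positivity
    simp only [compete_of_one_lt_add hs]
    exact (mul_nonneg hdet huv).trans_eq (by ring)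

lemma compete_eq_mixture_of_add_le_one (hx : 0 ≤ x) (hy : 0 ≤ y) (h : x + y ≤ 1) (a b : ℝ) :
    compete x y (x, (1 - x) * a) (y, (1 - y) * b) =
      (x / (x + y) * b) • (x + y, (1 - (x + y)) * a) +
        ((1 - x / (x + y)) * a) • (x + y, (1 - (x + y)) * b) := by
  have hx_cancel : x * (1 - y) / (1 - y) = x :=
    mul_div_cancel_of_imp fun _ => by linarith
  have hy_cancel : y * (1 - x) / (1 - x) = y :=
    mul_div_cancel_of_imp fun _ => by linarith
  have hxy_cancel : (1 - x - y) / ((1 - x) * (1 - y)) * ((1 - x) * (1 - y)) = 1 - x - y :=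
    div_mul_cancel_of_imp fun h0 => by rcases mul_eq_zero.1 h0 with h0 | h0 <;> linarith
  have hprob : x / (x + y) * (x + y) = x := div_mul_cancel_of_imp fun _ => by linarith
  rw [compete_of_add_le_one h]
  ext
  · simp only [Prod.fst_add, Prod.smul_fst, smul_eq_mul]
    linear_combination b * hx_cancel + a * hy_cancel + (a - b) * hprob
  · simp only [Prod.snd_add, Prod.smul_snd, smul_eq_mul]
    linear_combination a * b * hxy_cancel

lemma compete_eq_mixture_of_one_lt_add (hx : x ≤ 1) (hy : y ≤ 1) (h : 1 < x + y) (a b : ℝ) :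
    compete x y (x, (1 - x) * a) (y, (1 - y) * b) =
      ((1 - x) / (2 - x - y)) • (x + y - 1, (1 - (x + y - 1)) * a) +
        (1 - (1 - x) / (2 - x - y)) • (x + y - 1, (1 - (x + y - 1)) * b) := by
  have hx0 : x ≠ 0 := by linarith
  have hy0 : y ≠ 0 := by linarith
  have hprob : (1 - x) / (2 - x - y) * (2 - x - y) = 1 - x :=
    div_mul_cancel_of_imp fun _ => by linarith
  rw [compete_of_one_lt_add h]
  ext
  · simp only [Prod.fst_add, Prod.smul_fst, smul_eq_mul]
    field_simp
    ring
  · simp only [Prod.snd_add, Prod.smul_snd, smul_eq_mul]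
    rw [mul_div_cancel_left₀ _ hx0, mul_div_cancel_right₀ _ hy0]
    linear_combination (b - a) * hprob

end Match

namespace IndexTree

variable {ι : Type}

/-- The probability held by the index that moves up to the root, which does not depend on the
order or the outcomes of the matches. -/
noncomputable def mass (p : ι → ℝ) : IndexTree ι → ℝ
  | .leaf i => p i
  | .node l r => residual (l.mass p) (r.mass p)

lemma mass_congr {p q : ι → ℝ} : ∀ {T : IndexTree ι}, (∀ i ∈ T.leaves, p i = q i) →
    T.mass p = T.mass q
  | .leaf i, h => h i (List.mem_singleton_self i)
  | .node l r, h => by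
    simp only [leaves, List.forall_mem_append] at h
    rw [mass, mass, mass_congr h.1, mass_congr h.2]

lemma mass_mem_Icc {p : ι → ℝ} (hp : ∀ i, p i ∈ Set.Icc (0 : ℝ) 1) :
    ∀ T : IndexTree ι, T.mass p ∈ Set.Icc (0 : ℝ) 1
  | .leaf i => hp i
  | .node l r => residual_mem_Icc (mass_mem_Icc hp l) (mass_mem_Icc hp r)

variable [DecidableEq ι] {p q : ι → ℝ} {S S' : Finset ι} {i j : ι}

/-- Suppose that the index which moves up to the root is finally selected with probability equal
to its mass, independently of the matches within the tree. The components are the probabilities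
that all indices of `S` in the tree are selected and the index at the root is (first component) or
is not (second component) selected. Indices of `S` outside the tree play no role. -/
noncomputable def inclusionPair (p : ι → ℝ) (S : Finset ι) : IndexTree ι → ℝ × ℝ
  | .leaf i => (p i, (1 - p i) * if i ∈ S then 0 else 1)
  | .node l r => compete (l.mass p) (r.mass p) (l.inclusionPair p S) (r.inclusionPair p S)

lemma inclusionPair_node (p : ι → ℝ) (S : Finset ι) (l r : IndexTree ι) :
    (node l r).inclusionPair p S =
      compete (l.mass p) (r.mass p) (l.inclusionPair p S) (r.inclusionPair p S) :=
  rfl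

lemma inclusionPair_congr : ∀ {T : IndexTree ι}, (∀ i ∈ T.leaves, p i = q i) →
    (∀ i ∈ T.leaves, i ∈ S ↔ i ∈ S') → T.inclusionPair p S = T.inclusionPair q S'
  | .leaf i, hp, hS => by
    simp only [inclusionPair, hp i (List.mem_singleton_self i), hS i (List.mem_singleton_self i)]
  | .node l r, hp, hS => by
    simp only [leaves, List.forall_mem_append] at hp hS
    rw [inclusionPair_node, inclusionPair_node, mass_congr hp.1, mass_congr hp.2,
      inclusionPair_congr hp.1 hS.1, inclusionPair_congr hp.2 hS.2]

lemma inclusionPair_insert_of_notMem {T : IndexTree ι} (hi : i ∉ T.leaves) (p : ι → ℝ)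
    (S : Finset ι) : T.inclusionPair p (insert i S) = T.inclusionPair p S :=
  inclusionPair_congr (fun _ _ => rfl) fun _ hk =>
    Finset.mem_insert.trans (or_iff_right (ne_of_mem_of_not_mem hk hi))

lemma inclusionPair_nonneg (hp : ∀ i, p i ∈ Set.Icc (0 : ℝ) 1) (S : Finset ι) :
    ∀ T : IndexTree ι, 0 ≤ T.inclusionPair p S
  | .leaf i => ⟨(hp i).1, mul_nonneg (sub_nonneg.2 (hp i).2) (by split_ifs <;> norm_num)⟩
  | .node l r => compete_nonneg (mass_mem_Icc hp l) (mass_mem_Icc hp r)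
      (inclusionPair_nonneg hp S l) (inclusionPair_nonneg hp S r)

lemma likelihoodRatioLE_inclusionPair_insert (hp : ∀ i, p i ∈ Set.Icc (0 : ℝ) 1) (S : Finset ι)
    (i : ι) : ∀ {T : IndexTree ι}, T.leaves.Nodup →
      LikelihoodRatioLE (T.inclusionPair p S) (T.inclusionPair p (insert i S))
  | .leaf k, _ => by
    have hk : 0 ≤ p k * (1 - p k) := mul_nonneg (hp k).1 (sub_nonneg.2 (hp k).2)
    rcases eq_or_ne k i with rfl | hki
    · simp only [LikelihoodRatioLE, inclusionPair, Finset.mem_insert_self, if_true, mul_zero,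
        zero_mul]
      split_ifs <;> simp [hk]
    · simp [LikelihoodRatioLE, inclusionPair, hki, mul_comm]
  | .node l r, hT => by
    obtain ⟨hl, hr, hlr⟩ := List.nodup_append'.1 hT
    have hml := mass_mem_Icc hp l
    have hmr := mass_mem_Icc hp r
    by_cases hi : i ∈ l.leaves
    · rw [inclusionPair_node, inclusionPair_node, inclusionPair_insert_of_notMem (hlr hi)]
      exact (likelihoodRatioLE_inclusionPair_insert hp S i hl).compete_left hml hmr _
    · rw [inclusionPair_node, inclusionPair_node, inclusionPair_insert_of_notMem hi]
      exact (likelihoodRatioLE_inclusionPair_insert hp S i hr).compete_right hml hmr _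

lemma map_inclusionPair_node_mul_le {l r : IndexTree ι} (hl : l.leaves.Nodup)
    (hr : r.leaves.Nodup) (hi : i ∉ r.leaves) (hj : j ∉ l.leaves)
    (hp : ∀ i, p i ∈ Set.Icc (0 : ℝ) 1) (S : Finset ι) {φ : ℝ × ℝ →ₗ[ℝ] ℝ}
    (hφ : ∀ z, 0 ≤ z → 0 ≤ φ z) :
    φ ((node l r).inclusionPair p (insert i (insert j S))) * φ ((node l r).inclusionPair p S) ≤
      φ ((node l r).inclusionPair p (insert i S)) *
        φ ((node l r).inclusionPair p (insert j S)) := by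
  have hl_both : l.inclusionPair p (insert i (insert j S)) = l.inclusionPair p (insert i S) := by
    rw [Finset.insert_comm, inclusionPair_insert_of_notMem hj]
  simp only [inclusionPair_node, hl_both, inclusionPair_insert_of_notMem hi,
    inclusionPair_insert_of_notMem hj]
  exact map_compete_mul_map_compete_le hφ (mass_mem_Icc hp l) (mass_mem_Icc hp r)
    (likelihoodRatioLE_inclusionPair_insert hp S i hl)
    (likelihoodRatioLE_inclusionPair_insert hp S j hr)

lemma map_inclusionPair_mul_le (hp : ∀ i, p i ∈ Set.Icc (0 : ℝ) 1) (S : Finset ι) (hij : i ≠ j) :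
    ∀ {T : IndexTree ι}, T.leaves.Nodup →
      ∀ {φ : ℝ × ℝ →ₗ[ℝ] ℝ}, (∀ z, 0 ≤ z → 0 ≤ φ z) →
        φ (T.inclusionPair p (insert i (insert j S))) * φ (T.inclusionPair p S) ≤
          φ (T.inclusionPair p (insert i S)) * φ (T.inclusionPair p (insert j S))
  | .leaf k, _, φ, _ => by
    rcases eq_or_ne i k with rfl | hik
    · have hj : j ∉ (leaf i).leaves := by simpa [leaves] using hij.symm
      rw [Finset.insert_comm]
      simp only [inclusionPair_insert_of_notMem hj, le_refl]
    · have hi : i ∉ (leaf k).leaves := by simpa [leaves] using hik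
      simp only [inclusionPair_insert_of_notMem hi, mul_comm, le_refl]
  | .node l r, hT, φ, hφ => by
    obtain ⟨hl, hr, hlr⟩ := List.nodup_append'.1 hT
    have hml := mass_mem_Icc hp l
    have hmr := mass_mem_Icc hp r
    by_cases hi : i ∈ l.leaves <;> by_cases hj : j ∈ l.leaves
    · simp only [inclusionPair_node, inclusionPair_insert_of_notMem (hlr hi),
        inclusionPair_insert_of_notMem (hlr hj)]
      exact map_inclusionPair_mul_le hp S hij hl
        (φ := φ ∘ₗ (compete (l.mass p) (r.mass p)).flip (r.inclusionPair p S))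
        fun z hz => hφ _ (compete_nonneg hml hmr hz (inclusionPair_nonneg hp S r))
    · exact map_inclusionPair_node_mul_le hl hr (hlr hi) hj hp S hφ
    · rw [Finset.insert_comm]
      exact (map_inclusionPair_node_mul_le hl hr (hlr hj) hi hp S hφ).trans_eq (mul_comm _ _)
    · simp only [inclusionPair_node, inclusionPair_insert_of_notMem hi,
        inclusionPair_insert_of_notMem hj]
      exact map_inclusionPair_mul_le hp S hij hr
        (φ := φ ∘ₗ compete (l.mass p) (r.mass p) (l.inclusionPair p S))
        fun z hz => hφ _ (compete_nonneg hml hmr (inclusionPair_nonneg hp S l) hz)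

/-- Turns the joint probabilities with the final selection of the index at the root of a tree of
mass `m` into the probability under the final rule that this index is selected if and only if
`m = 1`. Since the second component refers to an event of probability `1 - m`, it is divided by
`1 - m`. -/
noncomputable def rootRule (m : ℝ) : ℝ × ℝ →ₗ[ℝ] ℝ :=
  if m = 1 then LinearMap.fst ℝ ℝ ℝ else (1 - m)⁻¹ • LinearMap.snd ℝ ℝ ℝ

lemma rootRule_nonneg {m : ℝ} (hm : m ≤ 1) {z : ℝ × ℝ} (hz : 0 ≤ z) : 0 ≤ rootRule m z := by
  unfold rootRule
  split_ifs
  · exact hz.1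
  · exact mul_nonneg (inv_nonneg.2 (sub_nonneg.2 hm)) hz.2

/-- The probability that all indices of `S` in the tree are selected, starting from the inclusion
probabilities `p`. Indices of `S` outside the tree play no role. -/
noncomputable def inclusionProb (p : ι → ℝ) (S : Finset ι) (T : IndexTree ι) : ℝ :=
  rootRule (T.mass p) (T.inclusionPair p S)

lemma inclusionProb_leaf (p : ι → ℝ) (S : Finset ι) (r : ι) :
    (leaf r).inclusionProb p S = if r ∈ S ∧ p r ≠ 1 then 0 else 1 := by
  by_cases hr : p r = 1
  · simp [inclusionProb, rootRule, mass, inclusionPair, hr]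
  · have : 1 - p r ≠ 0 := sub_ne_zero.2 (Ne.symm hr)
    simp [inclusionProb, rootRule, mass, inclusionPair, hr, this]

lemma inclusionProb_mul_le (hp : ∀ i, p i ∈ Set.Icc (0 : ℝ) 1) (S : Finset ι) (hij : i ≠ j)
    {T : IndexTree ι} (hT : T.leaves.Nodup) :
    T.inclusionProb p (insert i (insert j S)) * T.inclusionProb p S ≤
      T.inclusionProb p (insert i S) * T.inclusionProb p (insert j S) :=
  map_inclusionPair_mul_le hp S hij hT fun _ => rootRule_nonneg (mass_mem_Icc hp T).2

end IndexTree

open IndexTree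

namespace SiblingPair

variable {ι : Type} {T : IndexTree ι} {i j : ι} {C : ι → IndexTree ι}

lemma symm (h : SiblingPair T i j C) : SiblingPair T j i C := by
  induction h with
  | here i j => exact .swapped j i
  | swapped i j => exact .here j i
  | left _ ih => exact .left ih
  | right _ ih => exact .right ih

lemma leaves_perm (h : SiblingPair T i j C) : T.leaves.Perm (j :: (C i).leaves) := by
  induction h with
  | here i j => exact .swap j i []
  | swapped i j => exact .refl _
  | left _ ih => exact ih.append_right _
  | right _ ih => exact (ih.append_left _).trans List.perm_middle

lemma right_mem_leaves (h : SiblingPair T i j C) : j ∈ T.leaves :=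
  h.leaves_perm.mem_iff.2 List.mem_cons_self

lemma left_mem_leaves (h : SiblingPair T i j C) : i ∈ T.leaves :=
  h.symm.right_mem_leaves

lemma ne (h : SiblingPair T i j C) (hT : T.leaves.Nodup) : i ≠ j := by
  induction h with
  | here i j => simpa [leaves] using hT
  | swapped i j => simpa [leaves, eq_comm] using hT
  | left _ ih => exact ih hT.of_append_left
  | right _ ih => exact ih hT.of_append_right

lemma eqOn_of_disjoint (h : SiblingPair T i j C) {L : List ι} (hL : T.leaves.Disjoint L)
    {p q : ι → ℝ} (hq : ∀ k, k ≠ i → k ≠ j → q k = p k) : ∀ k ∈ L, q k = p k :=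
  fun k hk => hq k (fun hki => hL h.left_mem_leaves (hki ▸ hk))
    fun hkj => hL h.right_mem_leaves (hkj ▸ hk)

lemma mass_eq (h : SiblingPair T i j C) (hT : T.leaves.Nodup) {x : ι} {p q : ι → ℝ}
    (hq : ∀ k, k ≠ i → k ≠ j → q k = p k) (hx : q x = residual (p i) (p j)) :
    (C x).mass q = T.mass p := by
  induction h with
  | here i j => exact hx
  | swapped i j => exact hx.trans (residual_comm _ _)
  | left h ih =>
    obtain ⟨hl, -, hlr⟩ := List.nodup_append'.1 hT
    rw [mass, mass, ih hl hq hx, mass_congr (h.eqOn_of_disjoint hlr hq)]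
  | right h ih =>
    obtain ⟨-, hr, hlr⟩ := List.nodup_append'.1 hT
    rw [mass, mass, ih hr hq hx, mass_congr (h.eqOn_of_disjoint hlr.symm hq)]

variable [DecidableEq ι]

lemma toFinset_leaves (h : SiblingPair T i j C) (hT : T.leaves.Nodup) :
    (C i).leaves.toFinset = T.leaves.toFinset.erase j := by
  have hj : j ∉ (C i).leaves.toFinset := by
    rw [List.mem_toFinset]
    exact (List.nodup_cons.1 (h.leaves_perm.nodup_iff.1 hT)).1
  rw [List.toFinset_eq_of_perm _ _ h.leaves_perm, List.toFinset_cons, Finset.erase_insert hj]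

lemma subset_toFinset_leaves_union (h : SiblingPair T i j C) (hT : T.leaves.Nodup)
    {A S : Finset ι} (hj : j ∉ A) :
    S ⊆ (C i).leaves.toFinset ∪ A ↔ S ⊆ T.leaves.toFinset ∪ A ∧ j ∉ S := by
  rw [h.toFinset_leaves hT, ← Finset.subset_erase, Finset.erase_union_distrib,
    Finset.erase_eq_of_notMem hj]

lemma toFinset_leaves_union_insert (h : SiblingPair T i j C) (hT : T.leaves.Nodup) (A : Finset ι) :
    (C i).leaves.toFinset ∪ insert j A = T.leaves.toFinset ∪ A := by
  rw [h.toFinset_leaves hT, Finset.union_insert, ← Finset.insert_union,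
    Finset.insert_erase (List.mem_toFinset.2 h.right_mem_leaves)]

lemma exists_linearMap_inclusionPair (h : SiblingPair T i j C) (hT : T.leaves.Nodup) (p : ι → ℝ)
    (S : Finset ι) :
    ∃ L : ℝ × ℝ →ₗ[ℝ] ℝ × ℝ,
      T.inclusionPair p S =
        L (compete (p i) (p j) ((leaf i).inclusionPair p S) ((leaf j).inclusionPair p S)) ∧
      ∀ (x : ι) (q : ι → ℝ), (∀ k, k ≠ i → k ≠ j → q k = p k) → q x = residual (p i) (p j) →
        (C x).inclusionPair q S = L ((leaf x).inclusionPair q S) := by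
  induction h with
  | here i j => exact ⟨.id, rfl, fun _ _ _ _ => rfl⟩
  | swapped i j => exact ⟨.id, compete_comm _ _ _ _, fun _ _ _ _ => rfl⟩
  | @left l r i j C h ih =>
    obtain ⟨hl, -, hlr⟩ := List.nodup_append'.1 hT
    obtain ⟨L, hL, hC⟩ := ih hl
    refine ⟨(compete (l.mass p) (r.mass p)).flip (r.inclusionPair p S) ∘ₗ L, ?_,
      fun x q hq hx => ?_⟩
    · rw [inclusionPair_node, hL]; rfl
    · have hqp := h.eqOn_of_disjoint hlr hq
      rw [inclusionPair_node, h.mass_eq hl hq hx, hC x q hq hx, mass_congr hqp,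
        inclusionPair_congr hqp fun _ _ => Iff.rfl]
      rfl
  | @right l r i j C h ih =>
    obtain ⟨-, hr, hlr⟩ := List.nodup_append'.1 hT
    obtain ⟨L, hL, hC⟩ := ih hr
    refine ⟨compete (l.mass p) (r.mass p) (l.inclusionPair p S) ∘ₗ L, ?_, fun x q hq hx => ?_⟩
    · rw [inclusionPair_node, hL]; rfl
    · have hqp := h.eqOn_of_disjoint hlr.symm hq
      rw [inclusionPair_node, h.mass_eq hr hq hx, hC x q hq hx, mass_congr hqp,
        inclusionPair_congr hqp fun _ _ => Iff.rfl]
      rfl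

variable {p : ι → ℝ}

lemma inclusionProb_of_add_le_one (h : SiblingPair T i j C) (hT : T.leaves.Nodup)
    (hi : 0 ≤ p i) (hj : 0 ≤ p j) (hp : p i + p j ≤ 1) (S : Finset ι) :
    T.inclusionProb p S =
      p i / (p i + p j) * (if j ∈ S then 0 else (C i).inclusionProb
        (Function.update (Function.update p i (p i + p j)) j 0) S) +
      (1 - p i / (p i + p j)) * (if i ∈ S then 0 else (C j).inclusionProb
        (Function.update (Function.update p j (p i + p j)) i 0) S) := by
  set q := Function.update (Function.update p i (p i + p j)) j 0
  set q' := Function.update (Function.update p j (p i + p j)) i 0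
  have hij := h.ne hT
  have hq : ∀ k, k ≠ i → k ≠ j → q k = p k := fun k hki hkj => by simp [q, hki, hkj]
  have hq' : ∀ k, k ≠ i → k ≠ j → q' k = p k := fun k hki hkj => by simp [q', hki, hkj]
  have hqi : q i = p i + p j := by simp [q, hij]
  have hqj : q' j = p i + p j := by simp [q', hij.symm]
  have hres : residual (p i) (p j) = p i + p j := if_pos hp
  obtain ⟨L, hTL, hCL⟩ := h.exists_linearMap_inclusionPair hT p S
  rw [inclusionProb, inclusionProb, inclusionProb, h.mass_eq hT hq (hqi.trans hres.symm),
    h.mass_eq hT hq' (hqj.trans hres.symm), hTL, hCL i q hq (hqi.trans hres.symm),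
    hCL j q' hq' (hqj.trans hres.symm)]
  simp only [inclusionPair, hqi, hqj, compete_eq_mixture_of_add_le_one hi hj hp, map_add,
    map_smul, smul_eq_mul]
  split_ifs <;> ring

lemma inclusionProb_of_one_lt_add (h : SiblingPair T i j C) (hT : T.leaves.Nodup)
    (hi : p i ≤ 1) (hj : p j ≤ 1) (hp : 1 < p i + p j) (S : Finset ι) :
    T.inclusionProb p S =
      (1 - p i) / (2 - p i - p j) * (C i).inclusionProb
        (Function.update (Function.update p i (p i + p j - 1)) j 1) S +
      (1 - (1 - p i) / (2 - p i - p j)) * (C j).inclusionProb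
        (Function.update (Function.update p j (p i + p j - 1)) i 1) S := by
  set q := Function.update (Function.update p i (p i + p j - 1)) j 1
  set q' := Function.update (Function.update p j (p i + p j - 1)) i 1
  have hij := h.ne hT
  have hq : ∀ k, k ≠ i → k ≠ j → q k = p k := fun k hki hkj => by simp [q, hki, hkj]
  have hq' : ∀ k, k ≠ i → k ≠ j → q' k = p k := fun k hki hkj => by simp [q', hki, hkj]
  have hqi : q i = p i + p j - 1 := by simp [q, hij]
  have hqj : q' j = p i + p j - 1 := by simp [q', hij.symm]
  have hres : residual (p i) (p j) = p i + p j - 1 := if_neg hp.not_ge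
  obtain ⟨L, hTL, hCL⟩ := h.exists_linearMap_inclusionPair hT p S
  rw [inclusionProb, inclusionProb, inclusionProb, h.mass_eq hT hq (hqi.trans hres.symm),
    h.mass_eq hT hq' (hqj.trans hres.symm), hTL, hCL i q hq (hqi.trans hres.symm),
    hCL j q' hq' (hqj.trans hres.symm)]
  simp only [inclusionPair, hqi, hqj, compete_eq_mixture_of_one_lt_add hi hj hp, map_add,
    map_smul, smul_eq_mul]

end SiblingPair

/-- The event that all indices of `S` are in the sample. -/
def inclusionEvent {ι : Type} (S : Finset ι) : Set (ι → Bool) :=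
  {ξ | ∀ l ∈ S, ξ l = true}

lemma measurableSet_inclusionEvent {ι : Type} (S : Finset ι) :
    MeasurableSet (inclusionEvent S) := by
  have : inclusionEvent S = ⋂ l ∈ S, (fun ξ : ι → Bool => ξ l) ⁻¹' {true} := by
    ext; simp [inclusionEvent]
  rw [this]
  exact S.measurableSet_biInter fun l _ => measurable_pi_apply l (measurableSet_singleton true)

section Law

variable {ι : Type} [DecidableEq ι] {T : IndexTree ι} {p : ι → ℝ} {A : Finset ι}
  {μ : Measure (ι → Bool)}

lemma inclusionEvent_insert (S : Finset ι) (i : ι) :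
    inclusionEvent (insert i S) = inclusionEvent S ∩ {ξ | ξ i = true} := by
  ext; simp [inclusionEvent, and_comm]

/-- The invariants of a run: the indices stored at the leaves are distinct and not yet selected,
and all current inclusion probabilities lie in `[0, 1]`. -/
structure IsValidState (T : IndexTree ι) (p : ι → ℝ) (A : Finset ι) : Prop where
  nodup : T.leaves.Nodup
  disjoint : Disjoint T.leaves.toFinset A
  mem_Icc : ∀ i, p i ∈ Set.Icc (0 : ℝ) 1

lemma IsValidState.notMem_of_mem_leaves {i : ι} (hv : IsValidState T p A) (hi : i ∈ T.leaves) :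
    i ∉ A :=
  Finset.disjoint_left.1 hv.disjoint (List.mem_toFinset.2 hi)

lemma IsValidState.update {A' : Finset ι} {i j : ι} {C : ι → IndexTree ι}
    (hv : IsValidState T p A) (h : SiblingPair T i j C) (hA : A' ⊆ insert j A)
    {x y : ℝ} (hx : x ∈ Set.Icc (0 : ℝ) 1) (hy : y ∈ Set.Icc (0 : ℝ) 1) :
    IsValidState (C i) (Function.update (Function.update p i x) j y) A' where
  nodup := (h.leaves_perm.nodup_iff.1 hv.nodup).of_cons
  disjoint := by
    rw [h.toFinset_leaves hv.nodup]
    refine Disjoint.mono_right hA (Finset.disjoint_insert_right.2 ⟨Finset.notMem_erase _ _, ?_⟩)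
    exact hv.disjoint.mono_left (Finset.erase_subset _ _)
  mem_Icc := by
    have hpx := (Function.forall_update_iff p (a := i) fun _ z => z ∈ Set.Icc (0 : ℝ) 1).2
      ⟨hx, fun k _ => hv.mem_Icc k⟩
    exact (Function.forall_update_iff _ fun _ z => z ∈ Set.Icc (0 : ℝ) 1).2
      ⟨hy, fun k _ => hpx k⟩

namespace RunLaw

lemma isFiniteMeasure (h : RunLaw T p A μ) : IsFiniteMeasure μ := by
  induction h <;> infer_instance

lemma dirac_real_inclusionEvent {r : ι} (hr : r ∉ A) (S : Finset ι) :
    (Measure.dirac fun i => decide (i ∈ if p r = 1 then insert r A else A)).real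
        (inclusionEvent S) =
      if S ⊆ (leaf r).leaves.toFinset ∪ A then (leaf r).inclusionProb p S else 0 := by
  have hleaves : (leaf r).leaves.toFinset ∪ A = insert r A := by simp [leaves]
  have hsubset : S ⊆ (if p r = 1 then insert r A else A) ↔
      S ⊆ insert r A ∧ ¬(r ∈ S ∧ p r ≠ 1) := by
    split_ifs with hpr
    · simp [hpr]
    · simp only [hpr, ne_eq, not_false_eq_true, and_true, ← Finset.subset_erase,
        Finset.erase_insert hr]
  have hmem : (fun i => decide (i ∈ if p r = 1 then insert r A else A)) ∈ inclusionEvent S ↔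
      S ⊆ insert r A ∧ ¬(r ∈ S ∧ p r ≠ 1) := by
    rw [← hsubset]
    exact forall₂_congr fun _ _ => decide_eq_true_iff
  rw [measureReal_def, Measure.dirac_apply' _ (measurableSet_inclusionEvent S),
    hleaves, inclusionProb_leaf]
  classical
  rw [Set.indicator_apply, if_congr hmem rfl rfl]
  split_ifs <;> simp_all

lemma real_inclusionEvent (h : RunLaw T p A μ) (hv : IsValidState T p A) (S : Finset ι) :
    μ.real (inclusionEvent S) =
      if S ⊆ T.leaves.toFinset ∪ A then T.inclusionProb p S else 0 := by
  induction h with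
  | done r p A =>
    exact dirac_real_inclusionEvent (by simpa [leaves] using hv.disjoint) S
  | @low T i j C p A μ ν hT hp hi hj ihi ihj =>
    obtain ⟨hi0, -⟩ := hv.mem_Icc i
    obtain ⟨hj0, -⟩ := hv.mem_Icc j
    have := hi.isFiniteMeasure
    have := hj.isFiniteMeasure
    have hs : p i + p j ∈ Set.Icc (0 : ℝ) 1 := ⟨add_nonneg hi0 hj0, hp⟩
    have hq := unitInterval.div_mem hi0 hs.1 (le_add_of_nonneg_right hj0)
    have hiA := hv.notMem_of_mem_leaves hT.left_mem_leaves
    have hjA := hv.notMem_of_mem_leaves hT.right_mem_leaves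
    rw [mix_real_apply hq,
      ihi (hv.update hT (Finset.subset_insert j A) hs ⟨le_rfl, zero_le_one⟩),
      ihj (hv.update hT.symm (Finset.subset_insert i A) hs ⟨le_rfl, zero_le_one⟩),
      hT.inclusionProb_of_add_le_one hv.nodup hi0 hj0 hp,
      if_congr (hT.subset_toFinset_leaves_union hv.nodup hjA) rfl rfl,
      if_congr (hT.symm.subset_toFinset_leaves_union hv.nodup hiA) rfl rfl]
    split_ifs <;> simp_all
  | @high T i j C p A μ ν hT hp hi hj ihi ihj =>
    obtain ⟨-, hi1⟩ := hv.mem_Icc i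
    obtain ⟨-, hj1⟩ := hv.mem_Icc j
    have := hi.isFiniteMeasure
    have := hj.isFiniteMeasure
    have hs : p i + p j - 1 ∈ Set.Icc (0 : ℝ) 1 := by constructor <;> linarith
    have hq : (1 - p i) / (2 - p i - p j) ∈ Set.Icc (0 : ℝ) 1 :=
      unitInterval.div_mem (by linarith) (by linarith) (by linarith)
    rw [mix_real_apply hq, ihi (hv.update hT subset_rfl hs ⟨zero_le_one, le_rfl⟩),
      ihj (hv.update hT.symm subset_rfl (add_comm (p i) (p j) ▸ hs) ⟨zero_le_one, le_rfl⟩),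
      hT.inclusionProb_of_one_lt_add hv.nodup hi1 hj1 hp,
      hT.toFinset_leaves_union_insert hv.nodup, hT.symm.toFinset_leaves_union_insert hv.nodup]
    split_ifs <;> simp

end RunLaw

namespace IsPivotalLaw

lemma real_inclusionEvent (h : IsPivotalLaw T p μ) (hT : T.leaves.Nodup)
    (hp : ∀ i, p i ∈ Set.Icc (0 : ℝ) 1) (S : Finset ι) :
    μ.real (inclusionEvent S) = if S ⊆ T.leaves.toFinset then T.inclusionProb p S else 0 := by
  rw [RunLaw.real_inclusionEvent h ⟨hT, Finset.disjoint_empty_right _, hp⟩, Finset.union_empty]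

lemma real_inclusionEvent_mul_le (h : IsPivotalLaw T p μ) (hT : T.leaves.Nodup)
    (hp : ∀ i, p i ∈ Set.Icc (0 : ℝ) 1) (S : Finset ι) {i j : ι} (hij : i ≠ j) :
    μ.real (inclusionEvent (insert i (insert j S))) * μ.real (inclusionEvent S) ≤
      μ.real (inclusionEvent (insert i S)) * μ.real (inclusionEvent (insert j S)) := by
  by_cases hS : insert i (insert j S) ⊆ T.leaves.toFinset
  · obtain ⟨hi, hj, hS'⟩ := by simpa only [Finset.insert_subset_iff] using hS
    simp only [h.real_inclusionEvent hT hp, Finset.insert_subset_iff, hi, hj, hS', and_self,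
      if_true]
    exact inclusionProb_mul_le hp S hij hT
  · rw [h.real_inclusionEvent hT hp (insert i _), if_neg hS, zero_mul]
    positivity

end IsPivotalLaw

end Law

end PivotalSampling

open PivotalSampling in
theorem mainTheorem4_general {ι : Type} [DecidableEq ι] (T : IndexTree ι) (hT : T.leaves.Nodup)
    (p : ι → ℝ) (hp : ∀ i, p i ∈ Set.Icc (0 : ℝ) 1)
    (μ : Measure (ι → Bool)) (hμ : IsPivotalLaw T p μ)
    (S : Finset ι) (hS : 0 < μ {ξ | ∀ l ∈ S, ξ l = true}) (i j : ι) (hij : i ≠ j) :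
    μ[{ξ | ξ i = true ∧ ξ j = true} | {ξ | ∀ l ∈ S, ξ l = true}] ≤
      μ[{ξ | ξ i = true} | {ξ | ∀ l ∈ S, ξ l = true}] *
        μ[{ξ | ξ j = true} | {ξ | ∀ l ∈ S, ξ l = true}] := by
  have : IsFiniteMeasure μ := RunLaw.isFiniteMeasure hμ
  have h_joint : inclusionEvent (insert i (insert j S)) =
      inclusionEvent S ∩ ({ξ | ξ i = true} ∩ {ξ | ξ j = true}) := by
    rw [Finset.insert_comm, inclusionEvent_insert, inclusionEvent_insert, Set.inter_assoc]
  have h_neg := hμ.real_inclusionEvent_mul_le hT hp S hij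
  rw [h_joint, inclusionEvent_insert, inclusionEvent_insert] at h_neg
  exact cond_inter_le_mul_of_measureReal_mul_le (measurableSet_inclusionEvent S) hS.ne'
    (measure_ne_top μ _) h_neg

theorem mainTheorem4 {n k : ℕ} (T : PivotalSampling.IndexTree (Fin n))
    (hT : ∀ i, T.leaves.count i = 1)
    (p : Fin n → ℝ) (hp : ∀ i, p i ∈ Set.Icc (0 : ℝ) 1) (hk : ∑ i, p i = (k : ℝ))
    (μ : Measure (Fin n → Bool)) (hμ : PivotalSampling.IsPivotalLaw T p μ)
    (S : Finset (Fin n)) (hS : 0 < μ {ξ | ∀ l ∈ S, ξ l = true})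
    (i j : Fin n) (hi : i ∉ S) (hj : j ∉ S) (hij : i ≠ j) :
    μ[{ξ | ξ i = true ∧ ξ j = true} | {ξ | ∀ l ∈ S, ξ l = true}] ≤
      μ[{ξ | ξ i = true} | {ξ | ∀ l ∈ S, ξ l = true}] *
        μ[{ξ | ξ j = true} | {ξ | ∀ l ∈ S, ξ l = true}] :=
  mainTheorem4_general T (List.nodup_iff_count_le_one.2 fun i => (hT i).le) p hp μ hμ S hS i j hij
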